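/- Let $X$ be a finite metric space with $n\ge 2$ points and distance $|pq|$. Its doubling dimension $\gamma$ is the least real number such that every ball of radius $R>0$ in $X$ can be covered by at most $2^{\gamma}$ balls of radius $R/2$. Let $\alpha=\max_{u,v}|uv|/\min_{u\ne v}|uv|$ be the aspect ratio, let $|\mathrm{MST}|$ be the weight of a minimum spanning tree of $X$, and write $\lg^{*}\alpha=\max\{1,\log_2\alpha\}$. For $s>1$, the uncoordinated spanner construction starts from the graph on $X$ without edges and processes a finite sequence of checks, in an arbitrary order, in which every point $p$ checks the edge to every other point $q$. At the check of $(p,q)$, the undirected edge $pq$ is added unless the current graph already has an (undirected) edge $p'q'$ with $|pp'|\le \frac{|p'q'|}{2(s+1)}$ and $|qq'|\le\frac{|p'q'|}{2(s+1)}$. Let $G$ be the final graph. Then, for every $X$, every $s>1$ and every order of the checks, $G$ is a spanner with stretch factor $(s+1)/(s-1)$, that is, any two points $p,q$ are joined by a path in $G$ of total length at most $\frac{s+1}{s-1}|pq|$. Moreover: - the total weight (sum of edge lengths) of $G$ is at most $C\,\gamma^{9}\,\lg^{*}\alpha\,|\mathrm{MST}|\,s^{K\gamma}$; - $G$ has at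 most $C\,\gamma^{4}\,n\,s^{K\gamma}$ edges; - the maximum degree of $G$ is at most $C\,\gamma^{4}\,\lg^{*}\alpha\, s^{K\gamma}$; - the average degree of $G$ is at most $C\,\gamma^{4}\,s^{K\gamma}$, where the constants can be chosen in each of the following two ways: (a) for all $s>1$, with an absolute constant $K>0$ and a constant $C>0$ that depends only on $\gamma$; (b) for every fixed $s_0>1$ and all $s\ge s_0$, with constants $C,K>0$ that depend only on $s_0$ (and not on $\gamma$). -/

import Mathlib

universe u

namespace USpanner

noncomputable section

/-- The doubling dimension of a metric space: the least real `γ` such that every (closed) ball of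
radius `R > 0` is covered by at most `2 ^ γ` balls of radius `R / 2`, centred at points of the
space. -/
def doublingDim (X : Type u) [MetricSpace X] : ℝ :=
  sInf {γ : ℝ | ∀ (x : X) (R : ℝ), 0 < R → ∃ t : Finset X, (t.card : ℝ) ≤ (2 : ℝ) ^ γ ∧
    Metric.closedBall x R ⊆ ⋃ y ∈ t, Metric.closedBall y (R / 2)}

/-- The aspect ratio: largest pairwise distance over smallest distance of two distinct points. -/
def aspectRatio (X : Type u) [MetricSpace X] : ℝ :=
  Metric.diam (Set.univ : Set X) / Set.infsep (Set.univ : Set X)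

/-- The length of an (undirected) edge: the distance of its endpoints. -/
def edgeLength {X : Type u} [MetricSpace X] (e : Sym2 X) : ℝ :=
  Sym2.lift ⟨fun p q : X => dist p q, fun p q => dist_comm p q⟩ e

/-- `p q` is already served by `G`: there is an edge `p' q'` of `G` (named in either order) such
that `p`, `q` are within distance `|p'q'| / (2 (s + 1))` of `p'`, `q'` respectively. -/
def Blocked {X : Type u} [MetricSpace X] (s : ℝ) (G : SimpleGraph X) (p q : X) : Prop :=
  ∃ p' q' : X, G.Adj p' q' ∧
    dist p p' ≤ dist p' q' / (2 * (s + 1)) ∧ dist q q' ≤ dist p' q' / (2 * (s + 1))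

open Classical in
/-- One step: agent `e.1` checks the edge to `e.2`, and builds it unless it is blocked. -/
def check {X : Type u} [MetricSpace X] (s : ℝ) (G : SimpleGraph X) (e : X × X) : SimpleGraph X :=
  if Blocked s G e.1 e.2 then G else G ⊔ SimpleGraph.edge e.1 e.2

/-- A schedule: a finite sequence of checks, in arbitrary order, in which every agent checks the
edge to every other point (at least once). -/
def IsSchedule {X : Type u} (L : List (X × X)) : Prop :=
  ∀ p q : X, (p, q) ∈ L ↔ p ≠ q

/-- The graph built by carrying out the checks of `L` one after the other, from no edges. -/
def uncoordinated {X : Type u} [MetricSpace X] (s : ℝ) (L : List (X × X)) : SimpleGraph X :=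
  L.foldl (check s) ⊥

/-- The total length of the edges of a walk. -/
def walkLength {X : Type u} [MetricSpace X] {G : SimpleGraph X} {p q : X} (w : G.Walk p q) : ℝ :=
  (w.edges.map edgeLength).sum

/-- `G` is a spanner with stretch factor `t`: any two points are joined by a path of `G` of length
at most `t` times their distance. -/
def IsSpanner {X : Type u} [MetricSpace X] (t : ℝ) (G : SimpleGraph X) : Prop :=
  ∀ p q : X, ∃ w : G.Walk p q, w.IsPath ∧ walkLength w ≤ t * dist p q

open Classical in
/-- The total weight (sum of the edge lengths) of a graph on a finite metric space. -/
def weight {X : Type u} [MetricSpace X] [Fintype X] (G : SimpleGraph X) : ℝ :=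
  ∑ e ∈ G.edgeFinset, edgeLength e

/-- The weight of a minimum spanning tree (an infimum over a finite nonempty set if `X` is
nonempty). -/
def mstWeight (X : Type u) [MetricSpace X] [Fintype X] : ℝ :=
  sInf {w : ℝ | ∃ T : SimpleGraph X, T.IsTree ∧ w = weight T}

open Classical in
/-- The weight, size, maximum degree and average degree bounds, with `n` points, doubling
dimension `γ`, aspect ratio `α`, leading constant `C`, and `s ^ (K * γ)` for `s ^ O(γ)`. The factor
`lg α` is read as `max 1 (lg α)`, which is the same for `α ≥ 2`. -/
def SparsityBounds {X : Type u} [MetricSpace X] [Fintype X] (C K s : ℝ) (G : SimpleGraph X) :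
    Prop :=
  weight G ≤ C * (doublingDim X ^ 9 * max 1 (Real.logb 2 (aspectRatio X)) * mstWeight X *
    s ^ (K * doublingDim X)) ∧
  (G.edgeFinset.card : ℝ) ≤ C * (doublingDim X ^ 4 * Fintype.card X * s ^ (K * doublingDim X)) ∧
  (G.maxDegree : ℝ) ≤ C * (doublingDim X ^ 4 * max 1 (Real.logb 2 (aspectRatio X)) *
    s ^ (K * doublingDim X)) ∧
  (∑ v : X, (G.degree v : ℝ)) / Fintype.card X ≤
    C * (doublingDim X ^ 4 * s ^ (K * doublingDim X))

end

end USpanner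

/-! The checks yield two properties of the final graph. Every pair ends up blocked, and two edges of
length at least `r` whose endpoints match up within `r / (2 * (s + 1))` coincide (`EdgesSeparated`).
The first gives the stretch by induction on distance; everything else follows from the second by
packing.

Group the edges into dyadic length classes, of which there are `O(lg* α)`. With `2 ^ k ≈ s` and
doubling constant `D`, a vertex has at most `D ^ k` neighbours per class (`degree_le`). Rounding
endpoints to a net finer by `2 ^ k` is injective on a class (`card_classPairs_le`), so net pairs can
be counted instead.

Size: a net pair cannot lie wholly in a net coarser than its length, so it is charged to a point
that drops out within `k + 2` levels. Each point is charged in at most `k + 2` classes, whatever the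
aspect ratio (`card_edgeFinset_le`). Weight: disjoint balls around net points each contain tree
length at least their radius, so each class weighs a bounded multiple of the MST (`weight_le`).

Since `D ^ k` is `2 ^ O(γ) * s ^ O(γ)`, only the factor `2 ^ O(γ)` separates the two choices of
constants. The powers of `γ` are slack, as `1 ≤ γ`. -/

namespace USpanner

/-! ### Invariants of the sequence of checks. -/

section Construction

variable {X : Type u} [MetricSpace X]

theorem Blocked.mono {s : ℝ} {G H : SimpleGraph X} (h : G ≤ H) {p q : X}
    (hb : Blocked s G p q) : Blocked s H p q := by
  obtain ⟨p', q', ha, h1, h2⟩ := hb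
  exact ⟨p', q', h ha, h1, h2⟩

theorem Blocked.symm {s : ℝ} {G : SimpleGraph X} {p q : X}
    (hb : Blocked s G p q) : Blocked s G q p := by
  obtain ⟨p', q', ha, h1, h2⟩ := hb
  exact ⟨q', p', ha.symm, by rwa [dist_comm q' p'], by rwa [dist_comm q' p']⟩

theorem le_check (s : ℝ) (G : SimpleGraph X) (e : X × X) : G ≤ check s G e := by
  unfold check
  split_ifs
  · exact le_rfl
  · exact le_sup_left

theorem le_foldl_check (s : ℝ) (L : List (X × X)) :
    ∀ G : SimpleGraph X, G ≤ L.foldl (check s) G := by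
  induction L with
  | nil => exact fun G => le_rfl
  | cons e L ih => exact fun G => (le_check s G e).trans (ih _)

theorem blocked_check {s : ℝ} (hs : 0 ≤ s) (G : SimpleGraph X) {e : X × X} (he : e.1 ≠ e.2) :
    Blocked s (check s G e) e.1 e.2 := by
  unfold check
  split_ifs with h
  · exact h
  · refine ⟨e.1, e.2, ?_, ?_, ?_⟩
    · rw [SimpleGraph.sup_adj, SimpleGraph.edge_adj]
      exact Or.inr ⟨Or.inl ⟨rfl, rfl⟩, he⟩
    · rw [dist_self]; positivity
    · rw [dist_self]; positivity

theorem blocked_foldl_check {s : ℝ} (hs : 0 ≤ s) {p q : X} (hpq : p ≠ q) (L : List (X × X)) :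
    ∀ G : SimpleGraph X, (p, q) ∈ L → Blocked s (L.foldl (check s) G) p q := by
  induction L with
  | nil => intro G h; simp at h
  | cons e L ih =>
    intro G h
    rcases List.mem_cons.1 h with rfl | h
    · exact (blocked_check (e := (p, q)) hs G hpq).mono (le_foldl_check s L _)
    · exact ih _ h

/-- Two distinct edges of similar length have a pair of endpoints that are far apart. -/
def EdgesSeparated (s : ℝ) (G : SimpleGraph X) : Prop :=
  ∀ (p q p' q' : X) (r : ℝ), G.Adj p q → G.Adj p' q' → r ≤ dist p q → r ≤ dist p' q' →
    dist p p' ≤ r / (2 * (s + 1)) → dist q q' ≤ r / (2 * (s + 1)) → s(p, q) = s(p', q')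

/-- Of two close edges, the one added later would have been blocked by the earlier one. Using a
common lower bound `r` for both lengths makes the condition independent of which edge came first,
and `Blocked.symm` makes it independent of which endpoint checked. -/
theorem EdgesSeparated.check {s : ℝ} (hs : 0 ≤ s) {G : SimpleGraph X} (hG : EdgesSeparated s G)
    (e : X × X) : EdgesSeparated s (check s G e) := by
  unfold USpanner.check
  split_ifs with h
  · exact hG
  obtain ⟨a, b⟩ := e
  have key : ∀ (p q p' q' : X) (r : ℝ), s(p, q) = s(a, b) → G.Adj p' q' → r ≤ dist p' q' →
      dist p p' ≤ r / (2 * (s + 1)) → dist q q' ≤ r / (2 * (s + 1)) → False := by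
    intro p q p' q' r hpq hadj hr h1 h2
    have hb : Blocked s G p q := ⟨p', q', hadj, h1.trans (by gcongr), h2.trans (by gcongr)⟩
    rcases Sym2.eq_iff.1 hpq with ⟨rfl, rfl⟩ | ⟨rfl, rfl⟩
    · exact h hb
    · exact h hb.symm
  have hE : ∀ p q : X, (G ⊔ SimpleGraph.edge a b).Adj p q → G.Adj p q ∨ s(p, q) = s(a, b) := by
    intro p q hpq
    rw [SimpleGraph.sup_adj, SimpleGraph.edge_adj] at hpq
    rcases hpq with h | ⟨h, -⟩
    · exact Or.inl h
    · exact Or.inr (Sym2.eq_iff.2 (by tauto))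
  intro p q p' q' r h1 h2 hr1 hr2 hp hq
  rcases hE _ _ h1 with h1 | h1 <;> rcases hE _ _ h2 with h2 | h2
  · exact hG p q p' q' r h1 h2 hr1 hr2 hp hq
  · exact (key p' q' p q r h2 h1 hr1 (by rwa [dist_comm]) (by rwa [dist_comm])).elim
  · exact (key p q p' q' r h1 h2 hr2 hp hq).elim
  · exact h1.trans h2.symm

theorem edgesSeparated_uncoordinated {s : ℝ} (hs : 0 ≤ s) (L : List (X × X)) :
    EdgesSeparated s (uncoordinated s L) := by
  have : ∀ G : SimpleGraph X, EdgesSeparated s G → EdgesSeparated s (L.foldl (check s) G) := by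
    induction L with
    | nil => exact fun G hG => hG
    | cons e L ih => exact fun G hG => ih _ (hG.check hs e)
  exact this ⊥ fun p q p' q' r h => h.elim

end Construction

/-! ### The stretch factor. -/

section Stretch

variable {X : Type u} [MetricSpace X]

theorem edgeLength_nonneg (e : Sym2 X) : 0 ≤ edgeLength e := by
  induction e with
  | _ p q => exact dist_nonneg

theorem exists_path_walkLength_le {G : SimpleGraph X} {p q : X} (w : G.Walk p q) :
    ∃ w' : G.Walk p q, w'.IsPath ∧ walkLength w' ≤ walkLength w := by
  classical
  refine ⟨w.bypass, w.bypass_isPath, ?_⟩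
  have h : w.bypass.edges.Subperm w.edges :=
    w.bypass_isPath.isTrail.edges_nodup.subperm w.edges_bypass_subset_edges
  obtain ⟨l, hl, hs⟩ := h
  unfold walkLength
  rw [← (hl.map edgeLength).sum_eq]
  refine (hs.map edgeLength).sum_le_sum fun x hx => ?_
  obtain ⟨e, -, rfl⟩ := List.mem_map.1 hx
  exact edgeLength_nonneg e

/-- Take a counterexample at minimal distance. The blocking edge is joined to the pair by two
strictly shorter detours, which therefore have good walks. -/
theorem exists_walk_of_blocked [Finite X] {s : ℝ} (hs : 1 < s) {G : SimpleGraph X}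
    (hG : ∀ p q : X, p ≠ q → Blocked s G p q) (p q : X) :
    ∃ w : G.Walk p q, walkLength w ≤ (s + 1) / (s - 1) * dist p q := by
  by_contra hbad
  have hfin : {e : X × X | ¬ ∃ w : G.Walk e.1 e.2,
      walkLength w ≤ (s + 1) / (s - 1) * dist e.1 e.2}.Finite := Set.toFinite _
  obtain ⟨⟨a, b⟩, hab, hmin⟩ := Set.exists_min_image _ (fun e : X × X => dist e.1 e.2) hfin
    ⟨(p, q), hbad⟩
  have hlt : ∀ c d : X, dist c d < dist a b → ∃ w : G.Walk c d,
      walkLength w ≤ (s + 1) / (s - 1) * dist c d := by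
    intro c d hcd
    by_contra h
    exact absurd (hmin (c, d) h) (not_le.2 hcd)
  apply hab
  by_cases hne : a = b
  · subst hne
    exact ⟨SimpleGraph.Walk.nil, by simp [walkLength]⟩
  obtain ⟨a', b', hadj, h1, h2⟩ := hG a b hne
  have hs1 : 0 < s - 1 := by linarith
  set l := dist a' b' / (2 * (s + 1)) with hl
  have hL : dist a' b' = 2 * (s + 1) * l := by rw [hl]; field_simp
  have hl0 : 0 ≤ l := by positivity
  have htri : dist a' b' ≤ l + dist a b + l := by
    have := dist_triangle4 a' a b b'
    rw [dist_comm a' a] at this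
    linarith
  have hlab : 2 * s * l ≤ dist a b := by linarith
  have hpos : 0 < dist a b := dist_pos.2 hne
  have hl2 : l < dist a b := by nlinarith
  obtain ⟨w1, hw1⟩ := hlt a a' (h1.trans_lt hl2)
  obtain ⟨w2, hw2⟩ := hlt b' b (by rw [dist_comm]; exact h2.trans_lt hl2)
  refine ⟨w1.append (SimpleGraph.Walk.cons hadj w2), ?_⟩
  have hlen : walkLength (w1.append (SimpleGraph.Walk.cons hadj w2))
      = walkLength w1 + (dist a' b' + walkLength w2) := by
    simp [walkLength, SimpleGraph.Walk.edges_append, edgeLength]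
  rw [hlen]
  have ht : 0 ≤ (s + 1) / (s - 1) := by positivity
  have e1 := hw1.trans (mul_le_mul_of_nonneg_left h1 ht)
  have e2 := hw2.trans (mul_le_mul_of_nonneg_left (by rwa [dist_comm] at h2 : dist b' b ≤ l) ht)
  have e3 := mul_le_mul_of_nonneg_left hlab ht
  -- The stretch `t = (s + 1) / (s - 1)` is the solution of `2 * s * t = 2 * t + 2 * (s + 1)`: two
  -- detours of length at most `l` and one edge of length `2 * (s + 1) * l`.
  have e4 : (s + 1) / (s - 1) * (2 * s * l)
      = (s + 1) / (s - 1) * l + (2 * (s + 1) * l + (s + 1) / (s - 1) * l) := by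
    field_simp
    ring
  rw [dist_comm b b'] at h2
  linarith

theorem isSpanner_uncoordinated [Finite X] {s : ℝ} (hs : 1 < s) {L : List (X × X)}
    (hL : IsSchedule L) : IsSpanner ((s + 1) / (s - 1)) (uncoordinated s L) := by
  intro p q
  obtain ⟨w, hw⟩ := exists_walk_of_blocked hs (G := uncoordinated s L)
    (fun p q h => blocked_foldl_check (by linarith) h L ⊥ ((hL p q).2 h)) p q
  obtain ⟨w', hp, hw'⟩ := exists_path_walkLength_le w
  exact ⟨w', hp, hw'.trans hw⟩

end Stretch

/-! ### Packing in doubling spaces. -/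

section Packing

variable {X : Type u} [MetricSpace X]

/-- Every closed ball is covered by at most `D` closed balls of half its radius. -/
def HasDoublingConstant (X : Type u) [MetricSpace X] (D : ℝ) : Prop :=
  ∀ (x : X) (R : ℝ), 0 < R → ∃ t : Finset X, (t.card : ℝ) ≤ D ∧
    Metric.closedBall x R ⊆ ⋃ y ∈ t, Metric.closedBall y (R / 2)

theorem HasDoublingConstant.exists_cover {D : ℝ} (hD : HasDoublingConstant X D) (m : ℕ) :
    ∀ (x : X) (R : ℝ), 0 < R → ∃ t : Finset X, (t.card : ℝ) ≤ D ^ m ∧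
      Metric.closedBall x R ⊆ ⋃ y ∈ t, Metric.closedBall y (R / 2 ^ m) := by
  classical
  induction m with
  | zero =>
    intro x R _
    exact ⟨{x}, by simp, by simp⟩
  | succ m ih =>
    intro x R hR
    obtain ⟨t, ht, hc⟩ := hD x R hR
    have hD0 : 0 ≤ D := (Nat.cast_nonneg _).trans ht
    choose f hf hfc using fun y => ih y (R / 2) (by positivity)
    refine ⟨t.biUnion f, ?_, ?_⟩
    · calc ((t.biUnion f).card : ℝ) ≤ ∑ y ∈ t, ((f y).card : ℝ) := by
            exact_mod_cast Finset.card_biUnion_le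
        _ ≤ ∑ y ∈ t, D ^ m := Finset.sum_le_sum fun y _ => hf y
        _ = t.card * D ^ m := by simp
        _ ≤ D * D ^ m := by gcongr
        _ = D ^ (m + 1) := by ring
    · intro z hz
      obtain ⟨y, hy, hzy⟩ := Set.mem_iUnion₂.1 (hc hz)
      obtain ⟨w, hw, hzw⟩ := Set.mem_iUnion₂.1 (hfc y hzy)
      refine Set.mem_iUnion₂.2 ⟨w, Finset.mem_biUnion.2 ⟨y, hy, hw⟩, ?_⟩
      rwa [div_div, ← pow_succ'] at hzw

theorem HasDoublingConstant.card_le {D : ℝ} (hD : HasDoublingConstant X D) (m : ℕ) (x : X)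
    {R : ℝ} (hR : 0 < R) (S : Finset X) (hS : ∀ a ∈ S, dist a x ≤ R)
    (hsep : ∀ a ∈ S, ∀ b ∈ S, a ≠ b → 2 * R / 2 ^ m < dist a b) : (S.card : ℝ) ≤ D ^ m := by
  obtain ⟨t, ht, hc⟩ := hD.exists_cover m x R hR
  refine le_trans ?_ ht
  have : ∀ a, ∃ y, a ∈ S → y ∈ t ∧ dist a y ≤ R / 2 ^ m := by
    intro a
    by_cases ha : a ∈ S
    · obtain ⟨y, hy, h⟩ := Set.mem_iUnion₂.1 (hc (Metric.mem_closedBall.2 (hS a ha)))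
      exact ⟨y, fun _ => ⟨hy, h⟩⟩
    · exact ⟨a, fun h => (ha h).elim⟩
  choose f hf using this
  refine Nat.cast_le.2 (Finset.card_le_card_of_injOn f (fun a ha => (hf a ha).1) ?_)
  intro a ha b hb hab
  by_contra hne
  have h1 := hsep a ha b hb hne
  have h2 := (hf a ha).2
  have h3 := (hf b hb).2
  rw [← hab] at h3
  have h4 := dist_triangle_right a b (f a)
  have h5 : 2 * R / 2 ^ m = R / 2 ^ m + R / 2 ^ m := by ring
  linarith

/-- The ball around one point of a closest pair, with their distance as radius, contains both; a
ball of half that radius contains only its centre, so two are needed. -/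
theorem one_le_of_cover [Finite X] [Nontrivial X] {γ : ℝ}
    (hγ : HasDoublingConstant X ((2 : ℝ) ^ γ)) : 1 ≤ γ := by
  obtain ⟨x, -, y, -, hxy, hd⟩ :=
    (Set.nontrivial_univ (α := X)).infsep_exists_of_finite
  have hmin : ∀ a b : X, a ≠ b → dist x y ≤ dist a b := by
    intro a b hab
    rw [← hd]
    exact Set.infsep_le_dist_of_mem (Set.mem_univ a) (Set.mem_univ b) hab
  have hpos : 0 < dist x y := dist_pos.2 hxy
  obtain ⟨t, ht, hc⟩ := hγ x (dist x y) hpos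
  have hnear : ∀ z : X, dist z x ≤ dist x y → z ∈ t := by
    intro z hz
    obtain ⟨w, hw, h⟩ := Set.mem_iUnion₂.1 (hc (Metric.mem_closedBall.2 hz))
    rw [Metric.mem_closedBall] at h
    by_cases hzw : z = w
    · rwa [hzw]
    · linarith [hmin z w hzw]
  have h2 : 1 < t.card := Finset.one_lt_card.2
    ⟨x, hnear x (by simp), y, hnear y (dist_comm y x).le, hxy⟩
  have h3 : (2 : ℝ) ^ (1 : ℝ) ≤ 2 ^ γ := by
    rw [Real.rpow_one]
    exact le_trans (by exact_mod_cast h2) ht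
  exact (Real.rpow_le_rpow_left_iff (by norm_num)).1 h3

theorem cover_exponents_nonempty (X : Type u) [MetricSpace X] [Finite X] :
    {γ : ℝ | HasDoublingConstant X ((2 : ℝ) ^ γ)}.Nonempty := by
  have := Fintype.ofFinite X
  obtain ⟨n, hn⟩ := pow_unbounded_of_one_lt (Fintype.card X : ℝ) (one_lt_two (α := ℝ))
  refine ⟨n, fun x R hR => ⟨Finset.univ, ?_, fun z _ => ?_⟩⟩
  · rw [Real.rpow_natCast, Finset.card_univ]
    exact hn.le
  · exact Set.mem_iUnion₂.2 ⟨z, Finset.mem_univ z, Metric.mem_closedBall_self (by positivity)⟩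

theorem one_le_doublingDim [Finite X] [Nontrivial X] : 1 ≤ doublingDim X :=
  le_csInf (cover_exponents_nonempty X) fun _ h => one_le_of_cover h

/-- The strict inequality avoids the question whether the infimum is attained. -/
theorem hasDoublingConstant_of_doublingDim_lt [Finite X] {β : ℝ} (h : doublingDim X < β) :
    HasDoublingConstant X ((2 : ℝ) ^ β) := by
  obtain ⟨γ, hγ, hlt⟩ := exists_lt_of_csInf_lt (cover_exponents_nonempty X) h
  intro x R hR
  obtain ⟨t, ht, hc⟩ := hγ x R hR
  exact ⟨t, ht.trans (Real.rpow_le_rpow_of_exponent_le one_le_two hlt.le), hc⟩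

end Packing

/-! ### Nested nets. -/

section Nets

variable {X : Type u} [MetricSpace X]

theorem exists_net (S : Finset X) {r : ℝ} (hr : 0 < r) :
    ∃ T ⊆ S, (∀ a ∈ T, ∀ b ∈ T, a ≠ b → r ≤ dist a b) ∧ ∀ x ∈ S, ∃ a ∈ T, dist x a < r := by
  classical
  induction S using Finset.induction_on with
  | empty => exact ⟨∅, by simp⟩
  | insert x S _ ih =>
    obtain ⟨T, hTS, hsep, hcov⟩ := ih
    by_cases hx : ∃ a ∈ T, dist x a < r
    · refine ⟨T, hTS.trans (Finset.subset_insert _ _), hsep, fun y hy => ?_⟩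
      rcases Finset.mem_insert.1 hy with rfl | hy
      · exact hx
      · exact hcov y hy
    · push Not at hx
      refine ⟨insert x T, Finset.insert_subset_insert _ hTS, ?_, ?_⟩
      · intro a ha b hb hab
        rcases Finset.mem_insert.1 ha with rfl | ha' <;>
          rcases Finset.mem_insert.1 hb with rfl | hb'
        · exact (hab rfl).elim
        · exact hx b hb'
        · rw [dist_comm]; exact hx a ha'
        · exact hsep a ha' b hb' hab
      · intro y hy
        rcases Finset.mem_insert.1 hy with rfl | hy
        · exact ⟨y, Finset.mem_insert_self _ _, by simpa using hr⟩
        · obtain ⟨a, ha, h⟩ := hcov y hy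
          exact ⟨a, Finset.mem_insert_of_mem ha, h⟩

/-- A nested sequence of nets at the scales `2 ^ j * δ`, starting from the whole space. -/
structure NetHierarchy (X : Type u) [MetricSpace X] (δ : ℝ) where
  /-- The net at scale `2 ^ j * δ`. -/
  net : ℕ → Finset X
  antitone : Antitone net
  le_dist : ∀ j, ∀ a ∈ net j, ∀ b ∈ net j, a ≠ b → 2 ^ j * δ ≤ dist a b
  exists_near : ∀ j x, ∃ a ∈ net j, dist x a ≤ (2 ^ (j + 1) - 2) * δ

/-- Each net is extracted from the previous one, so covering radii add up: `2 + 4 + ... + 2 ^ j = 2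
^ (j + 1) - 2`. At `j = 0` this is `0`, as the bottom net is the whole space. -/
theorem exists_netHierarchy [Fintype X] {δ : ℝ} (hδ : 0 < δ)
    (hX : ∀ a b : X, a ≠ b → δ ≤ dist a b) : Nonempty (NetHierarchy X δ) := by
  choose T hTS hsep hcov using fun (S : Finset X) (j : ℕ) =>
    exists_net S (r := 2 ^ j * δ) (by positivity)
  let N : ℕ → Finset X := fun j => Nat.rec Finset.univ (fun j S => T S (j + 1)) j
  have hN : ∀ j, N (j + 1) = T (N j) (j + 1) := fun _ => rfl
  refine ⟨⟨N, antitone_nat_of_succ_le fun j => ?_, fun j => ?_, fun j => ?_⟩⟩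
  · rw [hN]
    exact hTS _ _
  · cases j with
    | zero => intro a _ b _ hab; simpa using hX a b hab
    | succ j =>
      rw [hN]
      exact hsep _ _
  · induction j with
    | zero => exact fun x => ⟨x, Finset.mem_univ x, by simp⟩
    | succ j ih =>
      intro x
      obtain ⟨a, ha, h1⟩ := ih x
      obtain ⟨b, hb, h2⟩ := hcov (N j) (j + 1) a ha
      refine ⟨b, by rwa [hN], ?_⟩
      have := dist_triangle x a b
      have e : ((2 : ℝ) ^ (j + 1 + 1) - 2) * δ = (2 ^ (j + 1) - 2) * δ + 2 ^ (j + 1) * δ := by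
        ring
      linarith

end Nets

/-! ### Lower bound on the MST by net size. -/

section SpanningTree

variable {X : Type u}

theorem abs_sub_le_sum_edges {G : SimpleGraph X} (h : X → ℝ) (g : Sym2 X → ℝ)
    (hg : ∀ u v, g s(u, v) = |h u - h v|) {p q : X} (w : G.Walk p q) :
    |h p - h q| ≤ (w.edges.map g).sum := by
  induction w with
  | nil => simp
  | cons hadj w ih =>
    rename_i a b c
    rw [SimpleGraph.Walk.edges_cons, List.map_cons, List.sum_cons, hg]
    exact (abs_sub_le _ (h b) _).trans (by gcongr)

open Classical in
theorem abs_sub_le_sum_edgeFinset [Fintype X] {G : SimpleGraph X} (hG : G.Connected) (h : X → ℝ)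
    (g : Sym2 X → ℝ) (hg : ∀ u v, g s(u, v) = |h u - h v|) (p q : X) :
    |h p - h q| ≤ ∑ e ∈ G.edgeFinset, g e := by
  obtain ⟨w, hw⟩ := (hG.preconnected p q).exists_isPath
  refine (abs_sub_le_sum_edges h g hg w).trans ?_
  rw [← List.sum_toFinset _ hw.isTrail.edges_nodup]
  refine Finset.sum_le_sum_of_subset_of_nonneg (fun e he => ?_) fun e _ _ => ?_
  · exact SimpleGraph.mem_edgeFinset.2 (w.edges_subset_edgeSet (List.mem_toFinset.1 he))
  · induction e with
    | _ u v => rw [hg]; exact abs_nonneg _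

variable [MetricSpace X]

/-- The variation of the truncated distance to `a` along an edge. -/
def truncVariation (r : ℝ) (a : X) (e : Sym2 X) : ℝ :=
  Sym2.lift ⟨fun u v : X => |min (dist u a) r - min (dist v a) r|,
    fun _ _ => abs_sub_comm _ _⟩ e

theorem truncVariation_mk (r : ℝ) (a u v : X) :
    truncVariation r a s(u, v) = |min (dist u a) r - min (dist v a) r| := rfl

theorem truncVariation_le (r : ℝ) (a : X) (e : Sym2 X) : truncVariation r a e ≤ edgeLength e := by
  induction e with
  | _ u v =>
    rw [truncVariation_mk]
    refine (abs_min_sub_min_le_max _ _ _ _).trans ?_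
    rw [sub_self, abs_zero]
    exact max_le (abs_dist_sub_le u v a) dist_nonneg

/-- The open balls of radius `r` around `N` are disjoint, so each endpoint lies in at most one;
every other truncated distance is constant on the edge. -/
theorem sum_truncVariation_le {r : ℝ} (N : Finset X)
    (hN : ∀ a ∈ N, ∀ b ∈ N, a ≠ b → 2 * r ≤ dist a b) (e : Sym2 X) :
    ∑ a ∈ N, truncVariation r a e ≤ 2 * edgeLength e := by
  classical
  induction e with
  | _ u v =>
    have hcard : ∀ w : X, (N.filter fun a => dist w a < r).card ≤ 1 := by
      intro w
      refine Finset.card_le_one.2 fun a ha b hb => ?_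
      rw [Finset.mem_filter] at ha hb
      by_contra hab
      have := hN a ha.1 b hb.1 hab
      have := dist_triangle_left a b w
      linarith
    calc ∑ a ∈ N, truncVariation r a s(u, v)
        ≤ ∑ a ∈ (N.filter fun a => dist u a < r) ∪ N.filter fun a => dist v a < r,
            truncVariation r a s(u, v) := by
          refine (Finset.sum_subset (Finset.union_subset (Finset.filter_subset _ _)
            (Finset.filter_subset _ _)) fun a ha hna => ?_).ge
          simp only [Finset.mem_union, Finset.mem_filter, ha, true_and, not_or, not_lt] at hna
          rw [truncVariation_mk, min_eq_right hna.1, min_eq_right hna.2, sub_self, abs_zero]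
      _ ≤ ∑ a ∈ (N.filter fun a => dist u a < r) ∪ N.filter fun a => dist v a < r,
            edgeLength s(u, v) := Finset.sum_le_sum fun a _ => truncVariation_le r a _
      _ ≤ 2 * edgeLength s(u, v) := by
          rw [Finset.sum_const, nsmul_eq_mul]
          refine mul_le_mul_of_nonneg_right ?_ (edgeLength_nonneg _)
          have h1 := Finset.card_union_le (N.filter fun a => dist u a < r)
            (N.filter fun a => dist v a < r)
          have h2 := hcard u
          have h3 := hcard v
          exact_mod_cast (by omega : _ ≤ 2)

/-- The tree path from another net point to `a` makes the truncated distance to `a` fall from `r` to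
`0`. Summing over `a` counts each edge at most twice. With a single net point no such path exists.
-/
theorem card_mul_le_weight [Fintype X] {T : SimpleGraph X} (hT : T.Connected) {r : ℝ}
    (hr : 0 ≤ r) (N : Finset X) (hN : ∀ a ∈ N, ∀ b ∈ N, a ≠ b → 2 * r ≤ dist a b)
    (hcard : 1 < N.card) : N.card * r ≤ 2 * weight T := by
  classical
  have hsep : ∀ a ∈ N, r ≤ ∑ e ∈ T.edgeFinset, truncVariation r a e := by
    intro a ha
    obtain ⟨b, hb, hba⟩ := Finset.exists_mem_ne hcard a
    have h := abs_sub_le_sum_edgeFinset hT (fun x => min (dist x a) r) (truncVariation r a)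
      (truncVariation_mk r a) b a
    have hr' : r ≤ dist b a := by linarith [hN b hb a ha hba]
    simp only [dist_self, min_eq_right hr', min_eq_left hr, sub_zero, abs_of_nonneg hr] at h
    convert h
  calc N.card * r = ∑ a ∈ N, r := by simp
    _ ≤ ∑ a ∈ N, ∑ e ∈ T.edgeFinset, truncVariation r a e := Finset.sum_le_sum hsep
    _ = ∑ e ∈ T.edgeFinset, ∑ a ∈ N, truncVariation r a e := Finset.sum_comm
    _ ≤ ∑ e ∈ T.edgeFinset, 2 * edgeLength e :=
        Finset.sum_le_sum fun e _ => sum_truncVariation_le N hN e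
    _ = 2 * weight T := by
        rw [← Finset.mul_sum, weight]

theorem spanningTree_weights_nonempty [Fintype X] [Nonempty X] :
    {w : ℝ | ∃ T : SimpleGraph X, T.IsTree ∧ w = weight T}.Nonempty := by
  obtain ⟨T, -, hT⟩ := (SimpleGraph.connected_top (V := X)).exists_isTree_le
  exact ⟨_, T, hT, rfl⟩

theorem mstWeight_nonneg [Fintype X] : 0 ≤ mstWeight X := by
  refine Real.sInf_nonneg ?_
  rintro _ ⟨T, -, rfl⟩
  exact Finset.sum_nonneg fun e _ => edgeLength_nonneg e

theorem card_mul_le_mstWeight [Fintype X] {r : ℝ} (hr : 0 ≤ r) (N : Finset X)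
    (hN : ∀ a ∈ N, ∀ b ∈ N, a ≠ b → 2 * r ≤ dist a b) (hcard : 1 < N.card) :
    N.card * r ≤ 2 * mstWeight X := by
  have : Nonempty X := ⟨(Finset.card_pos.1 (by omega : 0 < N.card)).choose⟩
  have h : N.card * r / 2 ≤ mstWeight X := by
    refine le_csInf spanningTree_weights_nonempty ?_
    rintro _ ⟨T, hT, rfl⟩
    linarith [card_mul_le_weight hT.connected hr N hN hcard]
  linarith

end SpanningTree

theorem card_le_card_mul {α β : Type*} [DecidableEq β] (P : Finset α) (S : Finset β) (f : α → β)
    (hf : ∀ e ∈ P, f e ∈ S) {M : ℝ} (hM : ∀ a ∈ S, ((P.filter fun e => f e = a).card : ℝ) ≤ M) :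
    (P.card : ℝ) ≤ S.card * M := by
  rw [Finset.card_eq_sum_card_fiberwise (f := f) (s := P) (t := S) hf, Nat.cast_sum]
  exact (Finset.sum_le_sum hM).trans_eq (by simp)

/-! ### Dyadic length classes. -/

section LengthClass

/-- The number `i` with `2 ^ i * δ ≤ x < 2 ^ (i + 1) * δ`. -/
noncomputable def lengthClass (δ x : ℝ) : ℕ := Nat.log 2 ⌊x / δ⌋₊

theorem pow_lengthClass_le {δ x : ℝ} (hδ : 0 < δ) (h : δ ≤ x) : 2 ^ lengthClass δ x * δ ≤ x := by
  have h1 : 1 ≤ x / δ := (one_le_div hδ).2 h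
  have h2 : ⌊x / δ⌋₊ ≠ 0 := (Nat.floor_pos.2 h1).ne'
  rw [← le_div_iff₀ hδ]
  refine le_trans ?_ (Nat.floor_le (by linarith : 0 ≤ x / δ))
  exact_mod_cast Nat.pow_log_le_self 2 h2

theorem lt_pow_lengthClass {δ : ℝ} (hδ : 0 < δ) (x : ℝ) : x < 2 ^ (lengthClass δ x + 1) * δ := by
  rw [← div_lt_iff₀ hδ]
  have h := Nat.lt_pow_succ_log_self one_lt_two ⌊x / δ⌋₊
  refine lt_of_lt_of_le (Nat.lt_floor_add_one _) ?_
  exact_mod_cast h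

theorem lengthClass_lt {δ x α : ℝ} (hδ : 0 < δ) (h : δ ≤ x) (hα : x ≤ α * δ) :
    lengthClass δ x < ⌊Real.logb 2 α⌋₊ + 1 := by
  have h1 : (2 : ℝ) ^ lengthClass δ x ≤ α :=
    le_of_mul_le_mul_right ((pow_lengthClass_le hδ h).trans hα) hδ
  refine Nat.lt_succ_of_le (Nat.le_floor ?_)
  rw [Real.le_logb_iff_rpow_le one_lt_two (lt_of_lt_of_le (by positivity) h1), Real.rpow_natCast]
  exact h1

end LengthClass

/-! ### Degree, size and weight by length class. -/

section Counting

variable {X : Type u} [MetricSpace X] {D s δ : ℝ} {G : SimpleGraph X} {k : ℕ}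

theorem card_neighbors_le (hD : HasDoublingConstant X D) (hs : 0 ≤ s) (hG : EdgesSeparated s G)
    (hk : 8 * (s + 1) ≤ 2 ^ k) (v : X) {r : ℝ} (hr : 0 < r) (S : Finset X)
    (hS : ∀ q ∈ S, G.Adj v q ∧ r ≤ dist v q ∧ dist v q ≤ 2 * r) : (S.card : ℝ) ≤ D ^ k := by
  -- Packing at radius `2 * r` needs gaps above `4 * r / 2 ^ k`, which is at most `r / (2 * (s +
  -- 1))` exactly when `8 * (s + 1) ≤ 2 ^ k`.
  refine hD.card_le k v (R := 2 * r) (by positivity) S (fun a ha => ?_) fun a ha b hb hab => ?_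
  · rw [dist_comm]; exact (hS a ha).2.2
  · by_contra h
    push Not at h
    refine hab (Sym2.congr_right.1 (hG v a v b r (hS a ha).1 (hS b hb).1 (hS a ha).2.1
      (hS b hb).2.1 (by rw [dist_self]; positivity) (h.trans ?_)))
    rw [div_le_div_iff₀ (by positivity) (by positivity)]
    nlinarith

theorem card_near_net_le (hD : HasDoublingConstant X D) (hδ : 0 < δ) (H : NetHierarchy X δ)
    (i : ℕ) (a : X) (S : Finset X)
    (hS : ∀ b ∈ S, b ∈ H.net (i - k) ∧ dist b a < 2 ^ (i + 2) * δ) :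
    (S.card : ℝ) ≤ D ^ (k + 4) := by
  refine hD.card_le (k + 4) a (R := 2 ^ (i + 2) * δ) (by positivity) S (fun b hb => (hS b hb).2.le)
    fun b hb c hc hbc => ?_
  refine lt_of_lt_of_le ?_ (H.le_dist (i - k) b (hS b hb).1 c (hS c hc).1 hbc)
  rw [div_lt_iff₀ (by positivity)]
  have e : (2 : ℝ) ^ i ≤ 2 ^ (i - k) * 2 ^ k := by
    rw [← pow_add]
    exact pow_le_pow_right₀ one_le_two (by omega)
  have h1 : (2 : ℝ) ^ i * δ ≤ 2 ^ (i - k) * 2 ^ k * δ := by gcongr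
  have h2 : (0 : ℝ) < 2 ^ i * δ := by positivity
  have e1 : 2 * ((2 : ℝ) ^ (i + 2) * δ) = 8 * (2 ^ i * δ) := by ring
  have e2 : (2 : ℝ) ^ (i - k) * δ * 2 ^ (k + 4) = 16 * (2 ^ (i - k) * 2 ^ k * δ) := by ring
  linarith

variable [Fintype X]

open Classical in
theorem degree_le (hD : HasDoublingConstant X D) (hs : 0 ≤ s) (hG : EdgesSeparated s G)
    (hk : 8 * (s + 1) ≤ 2 ^ k) (hδ : 0 < δ) (hX : ∀ a b : X, a ≠ b → δ ≤ dist a b) {I : ℕ}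
    (hI : ∀ a b : X, a ≠ b → lengthClass δ (dist a b) < I) (v : X) :
    (G.degree v : ℝ) ≤ I * D ^ k := by
  have h := card_le_card_mul (G.neighborFinset v) (Finset.range I)
    (fun q => lengthClass δ (dist v q)) (M := D ^ k) ?_ ?_
  · rwa [Finset.card_range] at h
  · intro q hq
    exact Finset.mem_range.2 (hI v q ((G.mem_neighborFinset v q).1 hq).ne)
  · intro i _
    refine card_neighbors_le hD hs hG hk v (r := 2 ^ i * δ) (by positivity) _ fun q hq => ?_
    rw [Finset.mem_filter, G.mem_neighborFinset] at hq
    obtain ⟨hq, rfl⟩ := hq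
    refine ⟨hq, pow_lengthClass_le hδ (hX v q hq.ne), ?_⟩
    rw [← mul_assoc, ← pow_succ']
    exact (lt_pow_lengthClass hδ _).le

open Classical in
/-- The ordered pairs of adjacent vertices whose distance is in `[2 ^ i * δ, 2 ^ (i + 1) * δ)`. -/
noncomputable def classPairs (G : SimpleGraph X) (δ : ℝ) (i : ℕ) : Finset (X × X) :=
  Finset.univ.filter fun e => G.Adj e.1 e.2 ∧ 2 ^ i * δ ≤ dist e.1 e.2 ∧
    dist e.1 e.2 < 2 ^ (i + 1) * δ

open Classical in
/-- The pairs of distinct points of the net at scale `2 ^ (i - k) * δ` that are closer than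
`2 ^ (i + 2) * δ`. -/
noncomputable def netPairs (H : NetHierarchy X δ) (k i : ℕ) : Finset (X × X) :=
  Finset.univ.filter fun e => e.1 ∈ H.net (i - k) ∧ e.2 ∈ H.net (i - k) ∧ e.1 ≠ e.2 ∧
    dist e.1 e.2 < 2 ^ (i + 2) * δ

theorem card_classPairs_le (hs : 1 < s) (hG : EdgesSeparated s G)
    (hk : 8 * (s + 1) ≤ 2 ^ k) (hδ : 0 < δ) (H : NetHierarchy X δ) (i : ℕ) :
    (classPairs G δ i).card ≤ (netPairs H k i).card := by
  set r : ℝ := 2 ^ i * δ with hr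
  have hr0 : 0 < r := by positivity
  have hnear : ∀ x, ∃ a ∈ H.net (i - k), dist x a ≤ r / (4 * (s + 1)) := by
    intro x
    obtain ⟨a, ha, h⟩ := H.exists_near (i - k) x
    refine ⟨a, ha, h.trans ?_⟩
    rcases le_total k i with hki | hki
    · rw [le_div_iff₀ (by linarith)]
      have e : (2 : ℝ) ^ (i - k) * 2 ^ k = 2 ^ i := by rw [← pow_add, Nat.sub_add_cancel hki]
      have hp : (0 : ℝ) < 2 ^ (i - k) * δ := by positivity
      have h1 : (2 ^ (i - k) * δ) * (8 * (s + 1)) ≤ (2 ^ (i - k) * δ) * 2 ^ k := by gcongr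
      have h2 : (2 ^ (i - k) * δ) * 2 ^ k = r := by rw [hr, ← e]; ring
      have h3 : 0 < δ * (s + 1) := mul_pos hδ (by linarith)
      rw [pow_succ]
      nlinarith
    -- Truncated subtraction selects the bottom net, where rounding moves nothing.
    · rw [Nat.sub_eq_zero_of_le hki]
      norm_num
      positivity
  choose f hfN hf using hnear
  set c := r / (4 * (s + 1)) with hc
  have hc2 : c + c = r / (2 * (s + 1)) := by rw [hc]; field_simp; ring
  have hcr : 8 * c ≤ r := by
    rw [hc, mul_div_assoc', div_le_iff₀ (by linarith)]
    nlinarith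
  have hclose : ∀ x y, f x = f y → dist x y ≤ c + c := by
    intro x y hxy
    have h1 := hf y
    rw [← hxy] at h1
    linarith [dist_triangle_right x y (f x), hf x]
  have hp1 : (2 : ℝ) ^ (i + 1) * δ = 2 * r := by rw [hr]; ring
  have hp2 : (2 : ℝ) ^ (i + 2) * δ = 4 * r := by rw [hr]; ring
  refine Finset.card_le_card_of_injOn (fun e => (f e.1, f e.2)) ?_ ?_
  · rintro ⟨p, q⟩ he
    simp only [classPairs, Finset.coe_filter, Finset.mem_univ, true_and, Set.mem_ofPred_eq] at he
    obtain ⟨-, h1, h2⟩ := he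
    simp only [netPairs, Finset.coe_filter, Finset.mem_univ, true_and, Set.mem_ofPred_eq]
    refine ⟨hfN p, hfN q, fun h => ?_, ?_⟩
    · linarith [hclose p q h]
    · have := dist_triangle4 (f p) p q (f q)
      rw [dist_comm (f p) p] at this
      linarith [hf p, hf q]
  · rintro ⟨p, q⟩ he ⟨p', q'⟩ he' hee
    simp only [classPairs, Finset.coe_filter, Finset.mem_univ, true_and, Set.mem_ofPred_eq] at he he'
    simp only [Prod.mk.injEq] at hee
    have h := hG p q p' q' r he.1 he'.1 he.2.1 he'.2.1 (by linarith [hclose p p' hee.1])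
      (by linarith [hclose q q' hee.2])
    rcases Sym2.eq_iff.1 h with ⟨rfl, rfl⟩ | ⟨rfl, rfl⟩
    · rfl
    -- A reversed copy of the same edge would have both endpoints rounded to one net point, which is
    -- impossible at length at least `r`.
    · linarith [hclose p q hee.1, he.2.1]

/-- The set `A` is left free so as to serve both the whole net (for weight) and the difference of
two nets (for size). -/
theorem card_le_of_fst_mem (hD : HasDoublingConstant X D) (hδ : 0 < δ) (H : NetHierarchy X δ)
    (i : ℕ) (A : Finset X) (P : Finset (X × X)) (hP : P ⊆ netPairs H k i)
    (hA : ∀ e ∈ P, e.1 ∈ A) : (P.card : ℝ) ≤ A.card * D ^ (k + 4) := by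
  classical
  refine card_le_card_mul P A Prod.fst hA fun a _ => ?_
  have hinj : Set.InjOn Prod.snd ((P.filter fun e => e.1 = a : Finset (X × X)) : Set (X × X)) := by
    rintro ⟨p, q⟩ h1 ⟨p', q'⟩ h2 h
    simp only [Finset.coe_filter, Set.mem_ofPred_eq] at h1 h2 h
    rw [h1.2, h2.2, h]
  rw [← Finset.card_image_of_injOn hinj]
  refine card_near_net_le hD hδ H i a _ fun b hb => ?_
  obtain ⟨⟨p, q⟩, he, rfl⟩ := Finset.mem_image.1 hb
  rw [Finset.mem_filter] at he
  obtain ⟨he, rfl⟩ := he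
  have := hP he
  simp only [netPairs, Finset.mem_filter, Finset.mem_univ, true_and] at this
  exact ⟨this.2.1, by rw [dist_comm]; exact this.2.2.2⟩

theorem card_netPairs_le (hD : HasDoublingConstant X D) (hδ : 0 < δ) (H : NetHierarchy X δ)
    (i : ℕ) : ((netPairs H k i).card : ℝ) ≤ (H.net (i - k)).card * D ^ (k + 4) := by
  refine card_le_of_fst_mem hD hδ H i _ _ subset_rfl fun e he => ?_
  simp only [netPairs, Finset.mem_filter] at he
  exact he.2.1

open Classical in
theorem card_netPairs_le_sdiff (hD : HasDoublingConstant X D) (hδ : 0 < δ) (H : NetHierarchy X δ)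
    (i : ℕ) : ((netPairs H k i).card : ℝ) ≤
      2 * ((H.net (i - k) \ H.net (i + 2)).card * D ^ (k + 4)) := by
  set P := (netPairs H k i).filter fun e => e.1 ∉ H.net (i + 2) with hP
  have hsub : netPairs H k i ⊆ P ∪ P.image Prod.swap := by
    rintro ⟨a, b⟩ h
    have h' := h
    simp only [netPairs, Finset.mem_filter, Finset.mem_univ, true_and] at h
    by_cases ha : a ∈ H.net (i + 2)
    -- Points of that net are at least `2 ^ (i + 2) * δ` apart, too far for a net pair. The swap
    -- accounts for the factor `2`.
    · have hb : b ∉ H.net (i + 2) := fun hb =>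
        absurd (H.le_dist _ a ha b hb h.2.2.1) (not_le.2 h.2.2.2)
      refine Finset.mem_union_right _ (Finset.mem_image.2 ⟨(b, a), ?_, rfl⟩)
      simp only [hP, netPairs, Finset.mem_filter, Finset.mem_univ, true_and]
      exact ⟨⟨h.2.1, h.1, h.2.2.1.symm, by rw [dist_comm]; exact h.2.2.2⟩, hb⟩
    · exact Finset.mem_union_left _ (Finset.mem_filter.2 ⟨h', ha⟩)
  have h1 : (netPairs H k i).card ≤ P.card + P.card :=
    (Finset.card_le_card hsub).trans ((Finset.card_union_le _ _).trans
      (Nat.add_le_add_left Finset.card_image_le _))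
  have h2 := card_le_of_fst_mem hD hδ H i (H.net (i - k) \ H.net (i + 2)) P
    (Finset.filter_subset _ _) (fun e he => ?_)
  · have h3 : ((netPairs H k i).card : ℝ) ≤ P.card + P.card := by exact_mod_cast h1
    linarith
  · simp only [hP, netPairs, Finset.mem_filter, Finset.mem_univ, true_and] at he
    exact Finset.mem_sdiff.2 ⟨he.1.1, he.2⟩

open Classical in
-- Double counting: if `m` is the first class charging `a`, then `a` has left the nets from level `m
-- + 2` on, so classes from `m + k + 2` on cannot charge it.
theorem sum_card_net_sdiff_le (H : NetHierarchy X δ) (k I : ℕ) :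
    ∑ i ∈ Finset.range I, (H.net (i - k) \ H.net (i + 2)).card ≤ Fintype.card X * (k + 2) := by
  have h1 : ∀ i, (H.net (i - k) \ H.net (i + 2)).card = (Finset.univ.bipartiteAbove
      (fun i a => a ∈ H.net (i - k) \ H.net (i + 2)) i).card := by
    intro i
    congr 1
    ext a
    simp [Finset.mem_bipartiteAbove]
  rw [Finset.sum_congr rfl fun i _ => h1 i,
    Finset.sum_card_bipartiteAbove_eq_sum_card_bipartiteBelow]
  refine (Finset.sum_le_card_nsmul _ _ (k + 2) fun a _ => ?_).trans_eq (by simp)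
  rcases Finset.eq_empty_or_nonempty ((Finset.range I).bipartiteBelow
    (fun i a => a ∈ H.net (i - k) \ H.net (i + 2)) a) with h | h
  · rw [h]; simp
  have hm := Finset.min'_mem _ h
  set m := Finset.min' _ h
  refine (Finset.card_le_card (t := Finset.Ico m (m + (k + 2))) fun i hi => ?_).trans_eq (by simp)
  have hmi := Finset.min'_le _ i hi
  rw [Finset.mem_bipartiteBelow, Finset.mem_sdiff] at hi hm
  refine Finset.mem_Ico.2 ⟨hmi, ?_⟩
  by_contra hlt
  exact hm.2.2 (H.antitone (by omega : m + 2 ≤ i - k) hi.2.1)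

open Classical in
/-- The edges with length in `[2 ^ i * δ, 2 ^ (i + 1) * δ)`. -/
noncomputable def classEdges (G : SimpleGraph X) (δ : ℝ) (i : ℕ) : Finset (Sym2 X) :=
  G.edgeFinset.filter fun e => lengthClass δ (edgeLength e) = i

theorem card_classEdges_le (hδ : 0 < δ) (hX : ∀ a b : X, a ≠ b → δ ≤ dist a b) (i : ℕ) :
    (classEdges G δ i).card ≤ (classPairs G δ i).card := by
  classical
  refine (Finset.card_le_card (t := (classPairs G δ i).image fun e => s(e.1, e.2))
    fun e he => ?_).trans Finset.card_image_le
  induction e with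
  | _ p q =>
    rw [classEdges, Finset.mem_filter] at he
    obtain ⟨he, rfl⟩ := he
    have hadj : G.Adj p q := SimpleGraph.mem_edgeFinset.1 he
    refine Finset.mem_image.2 ⟨(p, q), Finset.mem_filter.2 ⟨Finset.mem_univ _, hadj, ?_, ?_⟩, rfl⟩
    · exact pow_lengthClass_le hδ (hX p q hadj.ne)
    · exact lt_pow_lengthClass hδ _

open Classical in
theorem lengthClass_mem_range {I : ℕ} (hI : ∀ a b : X, a ≠ b → lengthClass δ (dist a b) < I)
    {e : Sym2 X} (he : e ∈ G.edgeFinset) : lengthClass δ (edgeLength e) ∈ Finset.range I := by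
  induction e with
  | _ p q =>
    have hadj : G.Adj p q := SimpleGraph.mem_edgeFinset.1 he
    exact Finset.mem_range.2 (hI p q hadj.ne)

open Classical in
theorem card_edgeFinset_le (hD : HasDoublingConstant X D) (hs : 1 < s) (hG : EdgesSeparated s G)
    (hk : 8 * (s + 1) ≤ 2 ^ k) (hδ : 0 < δ) (hX : ∀ a b : X, a ≠ b → δ ≤ dist a b) {I : ℕ}
    (hI : ∀ a b : X, a ≠ b → lengthClass δ (dist a b) < I) (hD0 : 0 ≤ D) :
    (G.edgeFinset.card : ℝ) ≤ 2 * (k + 2) * D ^ (k + 4) * Fintype.card X := by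
  obtain ⟨H⟩ := exists_netHierarchy hδ hX
  have h1 : G.edgeFinset.card = ∑ i ∈ Finset.range I, (classEdges G δ i).card :=
    Finset.card_eq_sum_card_fiberwise fun e he => lengthClass_mem_range hI he
  rw [h1, Nat.cast_sum]
  calc ∑ i ∈ Finset.range I, ((classEdges G δ i).card : ℝ)
      ≤ ∑ i ∈ Finset.range I, 2 * ((H.net (i - k) \ H.net (i + 2)).card * D ^ (k + 4)) := by
        refine Finset.sum_le_sum fun i _ => ?_
        refine le_trans ?_ (card_netPairs_le_sdiff hD hδ H i)
        exact_mod_cast (card_classEdges_le hδ hX i).trans (card_classPairs_le hs hG hk hδ H i)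
    _ = 2 * D ^ (k + 4) *
          ((∑ i ∈ Finset.range I, (H.net (i - k) \ H.net (i + 2)).card : ℕ) : ℝ) := by
        rw [Nat.cast_sum, Finset.mul_sum]
        exact Finset.sum_congr rfl fun i _ => by ring
    _ ≤ 2 * D ^ (k + 4) * ((Fintype.card X * (k + 2) : ℕ) : ℝ) := by
        gcongr
        exact sum_card_net_sdiff_le H k I
    _ = 2 * (k + 2) * D ^ (k + 4) * Fintype.card X := by push_cast; ring

theorem card_classEdges_mul_le (hD : HasDoublingConstant X D) (hs : 1 < s)
    (hG : EdgesSeparated s G) (hk : 8 * (s + 1) ≤ 2 ^ k) (hδ : 0 < δ)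
    (hX : ∀ a b : X, a ≠ b → δ ≤ dist a b) (hD0 : 0 ≤ D) (i : ℕ) :
    ((classEdges G δ i).card : ℝ) * (2 ^ (i + 1) * δ) ≤
      8 * 2 ^ k * D ^ (k + 4) * mstWeight X := by
  obtain ⟨H⟩ := exists_netHierarchy hδ hX
  have h1 := (card_classEdges_le (G := G) hδ hX i).trans (card_classPairs_le hs hG hk hδ H i)
  have hmst := mstWeight_nonneg (X := X)
  -- A net pair supplies the two net points that the MST bound requires.
  rcases Finset.eq_empty_or_nonempty (netPairs H k i) with h | ⟨⟨a, b⟩, hab⟩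
  · rw [h, Finset.card_empty] at h1
    rw [Nat.le_zero.1 h1]
    simp only [Nat.cast_zero, zero_mul]
    positivity
  simp only [netPairs, Finset.mem_filter, Finset.mem_univ, true_and] at hab
  have hcard : 1 < (H.net (i - k)).card :=
    Finset.one_lt_card.2 ⟨a, hab.1, b, hab.2.1, hab.2.2.1⟩
  have h2 := card_mul_le_mstWeight (r := 2 ^ (i - k) * δ / 2) (by positivity) (H.net (i - k))
    (fun a ha b hb hab => by linarith [H.le_dist _ a ha b hb hab]) hcard
  have h3 : ((classEdges G δ i).card : ℝ) ≤ (H.net (i - k)).card * D ^ (k + 4) :=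
    le_trans (by exact_mod_cast h1) (card_netPairs_le hD hδ H i)
  have e : (2 : ℝ) ^ i ≤ 2 ^ (i - k) * 2 ^ k := by
    rw [← pow_add]
    exact pow_le_pow_right₀ one_le_two (by omega)
  calc ((classEdges G δ i).card : ℝ) * (2 ^ (i + 1) * δ)
      = (classEdges G δ i).card * (2 * 2 ^ i * δ) := by ring
    _ ≤ ((H.net (i - k)).card * D ^ (k + 4)) * (2 * (2 ^ (i - k) * 2 ^ k) * δ) := by gcongr
    _ = 4 * 2 ^ k * D ^ (k + 4) * ((H.net (i - k)).card * (2 ^ (i - k) * δ / 2)) := by ring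
    _ ≤ 4 * 2 ^ k * D ^ (k + 4) * (2 * mstWeight X) := by gcongr
    _ = 8 * 2 ^ k * D ^ (k + 4) * mstWeight X := by ring

theorem weight_le (hD : HasDoublingConstant X D) (hs : 1 < s) (hG : EdgesSeparated s G)
    (hk : 8 * (s + 1) ≤ 2 ^ k) (hδ : 0 < δ) (hX : ∀ a b : X, a ≠ b → δ ≤ dist a b) {I : ℕ}
    (hI : ∀ a b : X, a ≠ b → lengthClass δ (dist a b) < I) (hD0 : 0 ≤ D) :
    weight G ≤ I * (8 * 2 ^ k * D ^ (k + 4) * mstWeight X) := by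
  classical
  have h1 : weight G = ∑ i ∈ Finset.range I, ∑ e ∈ classEdges G δ i, edgeLength e := by
    rw [weight]
    exact (Finset.sum_fiberwise_of_maps_to (fun e he => lengthClass_mem_range hI he) _).symm
  rw [h1]
  refine (Finset.sum_le_card_nsmul (Finset.range I) _
    (8 * 2 ^ k * D ^ (k + 4) * mstWeight X) fun i _ => ?_).trans_eq (by simp)
  refine le_trans ?_ (card_classEdges_mul_le hD hs hG hk hδ hX hD0 i)
  rw [← nsmul_eq_mul]
  refine Finset.sum_le_card_nsmul _ _ _ fun e he => ?_
  rw [classEdges, Finset.mem_filter] at he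
  obtain ⟨-, rfl⟩ := he
  exact (lt_pow_lengthClass hδ _).le

end Counting

/-! ### Assembling the bounds. -/

section Bounds

theorem infsep_pos_and_le (X : Type u) [MetricSpace X] [Finite X] [Nontrivial X] :
    0 < Set.infsep (Set.univ : Set X) ∧
      ∀ a b : X, a ≠ b → Set.infsep (Set.univ : Set X) ≤ dist a b := by
  refine ⟨?_, fun a b hab =>
    Set.infsep_le_dist_of_mem (Set.mem_univ a) (Set.mem_univ b) hab⟩
  obtain ⟨x, -, y, -, hxy, hd⟩ := (Set.nontrivial_univ (α := X)).infsep_exists_of_finite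
  rw [hd]
  exact dist_pos.2 hxy

open Classical in
theorem sparsityBounds_of_le {X : Type u} [MetricSpace X] [Fintype X] [Nontrivial X]
    {D s C K : ℝ} {k : ℕ} {G : SimpleGraph X} (hD : HasDoublingConstant X D) (hD1 : 1 ≤ D)
    (hs : 1 < s) (hG : EdgesSeparated s G) (hk : 8 * (s + 1) ≤ 2 ^ k)
    (hC : 16 * 2 ^ k * D ^ (k + 4) ≤ C * s ^ (K * doublingDim X)) :
    SparsityBounds C K s G := by
  have hD0 : 0 ≤ D := by linarith
  have hγ : 1 ≤ doublingDim X := one_le_doublingDim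
  obtain ⟨hδ, hX⟩ := infsep_pos_and_le X
  set δ := Set.infsep (Set.univ : Set X) with hδ_def
  set α := aspectRatio X with hα
  set l := max 1 (Real.logb 2 α) with hl
  have hl1 : 1 ≤ l := le_max_left _ _
  have hI : ∀ a b : X, a ≠ b → lengthClass δ (dist a b) < ⌊Real.logb 2 α⌋₊ + 1 := by
    intro a b hab
    refine lengthClass_lt hδ (hX a b hab) ?_
    rw [hα, aspectRatio, ← hδ_def, div_mul_cancel₀ _ hδ.ne']
    exact Metric.dist_le_diam_of_mem Set.finite_univ.isBounded (Set.mem_univ a) (Set.mem_univ b)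
  have hIl : ((⌊Real.logb 2 α⌋₊ + 1 : ℕ) : ℝ) ≤ 2 * l := by
    have h : (⌊Real.logb 2 α⌋₊ : ℝ) ≤ l := by
      rcases le_total 0 (Real.logb 2 α) with h | h
      · exact (Nat.floor_le h).trans (le_max_right _ _)
      · rw [Nat.floor_of_nonpos h, Nat.cast_zero]
        linarith
    push_cast
    linarith
  have hmst := mstWeight_nonneg (X := X)
  set I := ⌊Real.logb 2 α⌋₊ + 1
  set γ := doublingDim X
  set B := C * s ^ (K * γ) with hB
  set M := 2 ^ k * D ^ (k + 4) with hM
  have hMB : 16 * M ≤ B := by rw [hM, ← mul_assoc]; exact hC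
  have hM0 : 0 ≤ M := by positivity
  have hB0 : 0 ≤ B := by linarith
  have h9 : 1 ≤ γ ^ 9 := one_le_pow₀ hγ
  have h4 : 1 ≤ γ ^ 4 := one_le_pow₀ hγ
  have hedges : (G.edgeFinset.card : ℝ) ≤ 4 * M * Fintype.card X := by
    refine (card_edgeFinset_le hD hs hG hk hδ hX hI hD0).trans ?_
    have hk2 : (k : ℝ) + 1 ≤ 2 ^ k := by exact_mod_cast k.lt_two_pow_self
    have hk3 : (k : ℝ) + 2 ≤ 2 * 2 ^ k := by
      linarith [one_le_pow₀ (one_le_two (α := ℝ)) (n := k)]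
    calc 2 * ((k : ℝ) + 2) * D ^ (k + 4) * Fintype.card X
        ≤ 2 * (2 * 2 ^ k) * D ^ (k + 4) * Fintype.card X := by gcongr
      _ = 4 * M * Fintype.card X := by rw [hM]; ring
  have hn : (0 : ℝ) < Fintype.card X := by exact_mod_cast Fintype.card_pos
  refine ⟨?_, ?_, ?_, ?_⟩
  · calc weight G ≤ I * (8 * 2 ^ k * D ^ (k + 4) * mstWeight X) :=
          weight_le hD hs hG hk hδ hX hI hD0
      _ ≤ 2 * l * (8 * 2 ^ k * D ^ (k + 4) * mstWeight X) := by gcongr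
      _ = 1 * (l * mstWeight X * (16 * M)) := by rw [hM]; ring
      _ ≤ γ ^ 9 * (l * mstWeight X * B) := by gcongr
      _ = C * (γ ^ 9 * l * mstWeight X * s ^ (K * γ)) := by rw [hB]; ring
  · calc (G.edgeFinset.card : ℝ) ≤ 4 * M * Fintype.card X := hedges
      _ ≤ 1 * (B * Fintype.card X) := by
          rw [one_mul]
          gcongr
          linarith
      _ ≤ γ ^ 4 * (B * Fintype.card X) := by gcongr
      _ = C * (γ ^ 4 * Fintype.card X * s ^ (K * γ)) := by rw [hB]; ring
  · obtain ⟨v, hv⟩ := G.exists_maximal_degree_vertex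
    have hDk : D ^ k ≤ M := by
      calc D ^ k ≤ D ^ (k + 4) := pow_le_pow_right₀ hD1 (by omega)
        _ = 1 * D ^ (k + 4) := (one_mul _).symm
        _ ≤ M := by
            rw [hM]
            gcongr
            exact one_le_pow₀ one_le_two
    calc (G.maxDegree : ℝ) = G.degree v := by rw [hv]
      _ ≤ I * D ^ k := degree_le hD (by linarith) hG hk hδ hX hI v
      _ ≤ 2 * l * M := by gcongr
      _ ≤ 1 * (l * B) := by nlinarith
      _ ≤ γ ^ 4 * (l * B) := by gcongr
      _ = C * (γ ^ 4 * l * s ^ (K * γ)) := by rw [hB]; ring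
  · rw [div_le_iff₀ hn]
    calc ∑ v : X, (G.degree v : ℝ) = 2 * G.edgeFinset.card := by
          exact_mod_cast G.sum_degrees_eq_twice_card_edges
      _ ≤ 1 * (B * Fintype.card X) := by nlinarith
      _ ≤ γ ^ 4 * (B * Fintype.card X) := by gcongr
      _ = C * (γ ^ 4 * s ^ (K * γ)) * Fintype.card X := by rw [hB]; ring

theorem exists_pow_two_near {x : ℝ} (hx : 1 ≤ x) : ∃ k : ℕ, x ≤ 2 ^ k ∧ (2 : ℝ) ^ k ≤ 2 * x := by
  obtain ⟨n, h1, h2⟩ := exists_nat_pow_near hx one_lt_two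
  exact ⟨n + 1, h2.le, by rw [pow_succ']; gcongr⟩

theorem sparsityBounds_uncoordinated {X : Type u} [MetricSpace X] [Fintype X] [Nontrivial X]
    {s C K : ℝ} (hs : 1 < s) (L : List (X × X))
    (hC : 2 ^ (9 + 18 * doublingDim X) * s ^ (4 * doublingDim X) ≤
      C * s ^ (K * doublingDim X)) :
    SparsityBounds C K s (uncoordinated s L) := by
  have hγ : 1 ≤ doublingDim X := one_le_doublingDim
  obtain ⟨k, hk, hk2⟩ := exists_pow_two_near (x := 8 * (s + 1)) (by linarith)
  -- Doubling the exponent gives a value strictly above the dimension, because the latter is at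
  -- least `1`.
  refine sparsityBounds_of_le (hasDoublingConstant_of_doublingDim_lt (β := 2 * doublingDim X)
    (by linarith)) (Real.one_le_rpow one_le_two (by linarith)) hs
    (edgesSeparated_uncoordinated (by linarith) L) hk (le_trans ?_ hC)
  set γ := doublingDim X
  have hs0 : 0 < s := by linarith
  have hks : (2 : ℝ) ^ k ≤ 32 * s := by linarith
  -- Exchanging exponents gives base `2 ^ (k + 4) ≤ 16 * (32 * s) = 512 * s`.
  have h1 : ((2 : ℝ) ^ (2 * γ)) ^ (k + 4) ≤ (512 * s) ^ (2 * γ) := by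
    rw [← Real.rpow_natCast, ← Real.rpow_mul two_pos.le, mul_comm, Real.rpow_mul two_pos.le,
      Real.rpow_natCast]
    refine Real.rpow_le_rpow (by positivity) ?_ (by linarith)
    rw [pow_add]
    linarith
  have h2 : ((512 : ℝ) * s) ^ (2 * γ) = 2 ^ (18 * γ) * s ^ (2 * γ) := by
    rw [Real.mul_rpow (by norm_num) hs0.le]
    congr 1
    rw [show (512 : ℝ) = 2 ^ (9 : ℝ) by norm_num, ← Real.rpow_mul (by norm_num)]
    ring_nf
  have h3 : s ≤ s ^ (2 * γ) := Real.self_le_rpow_of_one_le hs.le (by linarith)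
  calc 16 * 2 ^ k * ((2 : ℝ) ^ (2 * γ)) ^ (k + 4)
      ≤ 16 * (32 * s ^ (2 * γ)) * (2 ^ (18 * γ) * s ^ (2 * γ)) := by
        rw [← h2]
        gcongr
        exact hks.trans (by gcongr)
    _ = 2 ^ (9 + 18 * γ) * s ^ (4 * γ) := by
        rw [Real.rpow_add two_pos, show 4 * γ = 2 * γ + 2 * γ by ring, Real.rpow_add hs0]
        norm_num
        ring

end Bounds

end USpanner

/-! ### The two choices of constants. -/

theorem mainTheorem7 :
    -- the stretch factor
    (∀ (X : Type u) [MetricSpace X] [Fintype X] [Nontrivial X] (s : ℝ) (L : List (X × X)),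
      1 < s → USpanner.IsSchedule L →
        USpanner.IsSpanner ((s + 1) / (s - 1)) (USpanner.uncoordinated s L)) ∧
    -- all `s > 1`; the leading constant depends on the (constant) doubling dimension only
    (∃ K : ℝ, 0 < K ∧ ∀ γ : ℝ, ∃ C : ℝ, 0 < C ∧
      ∀ (X : Type u) [MetricSpace X] [Fintype X] [Nontrivial X] (s : ℝ) (L : List (X × X)),
        USpanner.doublingDim X = γ → 1 < s → USpanner.IsSchedule L →
          USpanner.SparsityBounds C K s (USpanner.uncoordinated s L)) ∧
    -- `s` bounded away from `1`; no constant depends on the doubling dimension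
    (∀ s₀ : ℝ, 1 < s₀ → ∃ C K : ℝ, 0 < C ∧ 0 < K ∧
      ∀ (X : Type u) [MetricSpace X] [Fintype X] [Nontrivial X] (s : ℝ) (L : List (X × X)),
        s₀ ≤ s → USpanner.IsSchedule L →
          USpanner.SparsityBounds C K s (USpanner.uncoordinated s L)) := by
  refine ⟨fun X _ _ _ s L hs hL => USpanner.isSpanner_uncoordinated hs hL,
    ⟨4, by norm_num, fun γ => ⟨2 ^ (9 + 18 * γ), by positivity, ?_⟩⟩, fun s₀ hs₀ => ?_⟩
  · intro X _ _ _ s L hγ hs _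
    exact USpanner.sparsityBounds_uncoordinated hs L (by rw [hγ])
  · have hlog : 0 < Real.logb s₀ 2 := Real.logb_pos hs₀ one_lt_two
    -- Since `2 ≤ s ^ Real.logb s₀ 2` for `s ≥ s₀`, the factor `2 ^ (18 * γ)` moves into the power
    -- of `s`.
    refine ⟨2 ^ (9 : ℝ), 4 + 18 * Real.logb s₀ 2, by positivity, by positivity, ?_⟩
    intro X _ _ _ s L hs _
    have hs1 : 1 < s := hs₀.trans_le hs
    refine USpanner.sparsityBounds_uncoordinated hs1 L ?_
    have hγ : 1 ≤ USpanner.doublingDim X := USpanner.one_le_doublingDim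
    set γ := USpanner.doublingDim X
    have h2 : (2 : ℝ) ≤ s ^ Real.logb s₀ 2 := by
      calc (2 : ℝ) = s₀ ^ Real.logb s₀ 2 :=
            (Real.rpow_logb (by linarith) hs₀.ne' two_pos).symm
        _ ≤ s ^ Real.logb s₀ 2 := Real.rpow_le_rpow (by linarith) hs hlog.le
    have h3 : (2 : ℝ) ^ (18 * γ) ≤ s ^ (18 * Real.logb s₀ 2 * γ) := by
      calc (2 : ℝ) ^ (18 * γ) ≤ (s ^ Real.logb s₀ 2) ^ (18 * γ) :=
            Real.rpow_le_rpow (by norm_num) h2 (by linarith)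
        _ = s ^ (18 * Real.logb s₀ 2 * γ) := by
            rw [← Real.rpow_mul (by linarith)]
            ring_nf
    calc (2 : ℝ) ^ (9 + 18 * γ) * s ^ (4 * γ)
        = 2 ^ (9 : ℝ) * (2 ^ (18 * γ) * s ^ (4 * γ)) := by rw [Real.rpow_add two_pos, mul_assoc]
      _ ≤ 2 ^ (9 : ℝ) * (s ^ (18 * Real.logb s₀ 2 * γ) * s ^ (4 * γ)) := by gcongr
      _ = 2 ^ (9 : ℝ) * s ^ ((4 + 18 * Real.logb s₀ 2) * γ) := by
          rw [← Real.rpow_add (by linarith)]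
          ring_nf
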